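/- Let $G$ be a Gromov-hyperbolic group, that is, a group with a finite generating set $A$ whose word metric is hyperbolic. Let $X=\partial G$ be its Gromov boundary: geodesic rays in the Cayley graph modulo bounded distance, with the quotient of the topology of pointwise convergence and with the action of $G$ by left translation. (1) Let $S$ be a compact connected complex manifold, $p:\tilde S\to S$ its universal covering, $\Gamma\cong\pi_1(S)$ the group of deck transformations of $p$, and $\rho:\Gamma\to G$ any homomorphism. Let $M_\rho=(\tilde S\times X)/\Gamma$ be the foliated bundle over $S$ with fiber $X$, where $\gamma\in\Gamma$ acts by $\gamma(z,x)=(\gamma z,\rho(\gamma)x)$. Its leaves are the images of the slices $\tilde S\times\{x\}$, $x\in X$, with the complex structures for which the maps $\tilde S\to M_\rho$, $z\mapsto[z,x]$, are holomorphic coverings of the leaves. Then $M_\rho$ is holomorphically plain: every continuous function $f:M_\rho\to\mathbb{C}$ that is holomorphic on each leaf is constant on each leaf. (2) For every subgroup $H$ of $G$ that is unbounded in the word metric, $X$ is a convergence $H$-space in the following sense: there is an at most countable family of subsets $X_i\subset X$ such that $\bigcap_i X_i$ is at most countable, and for each $i$ there are a sequence $(h_m)$ in $H$ and a point $x_i\in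 X$ with $h_m y\to x_i$ as $m\to\infty$ for each $y\in X\setminus X_i$. -/

import Mathlib

open scoped Manifold ContDiff Topology

/-! ### Gromov-hyperbolic groups -/

section Hyperbolic

variable {G : Type*} [Group G]

/-- The word metric of `G` with respect to `S`, as the path metric of the Cayley graph
(`g` and `h` are joined by an edge when `g⁻¹ * h ∈ S ∪ S⁻¹` and `g ≠ h`). -/
noncomputable def wordDist (S : Set G) (g h : G) : ℝ :=
  ((SimpleGraph.mulCayley S).dist g h : ℝ)

/-- The Gromov product of `x` and `y` with base point `w` for the word metric. -/
noncomputable def gromovProduct (S : Set G) (w x y : G) : ℝ :=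
  (wordDist S x w + wordDist S y w - wordDist S x y) / 2

/-- `S` is a finite generating set of `G` whose word metric is hyperbolic in the sense of Gromov.
A group is Gromov-hyperbolic when it has such a generating set. -/
structure IsHyperbolicGeneratingSet (S : Set G) : Prop where
  finite : S.Finite
  closure_eq_top : Subgroup.closure S = ⊤
  hyperbolic : ∃ δ : ℝ, ∀ w x y z : G,
    min (gromovProduct S w x y) (gromovProduct S w y z) - δ ≤ gromovProduct S w x z

/-- A subgroup that is unbounded for the word metric. -/
def IsUnboundedSubgroup (S : Set G) (H : Subgroup G) : Prop :=
  ∀ C : ℝ, ∃ h ∈ H, C < wordDist S 1 h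

/-- Left multiplication preserves the extended path metric of the Cayley graph. -/
theorem mulCayley_edist_mul_left (S : Set G) (g x y : G) :
    (SimpleGraph.mulCayley S).edist (g * x) (g * y) = (SimpleGraph.mulCayley S).edist x y := by
  have key : ∀ g x y : G, (SimpleGraph.mulCayley S).edist (g * x) (g * y) ≤
      (SimpleGraph.mulCayley S).edist x y := by
    intro g x y
    refine le_iInf fun w => ?_
    let φ : SimpleGraph.mulCayley S →g SimpleGraph.mulCayley S :=
      ⟨fun a => g * a, fun h => SimpleGraph.mulCayley_adj_mul_iff_right.mpr h⟩
    have := SimpleGraph.edist_le (w.map φ)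
    rwa [SimpleGraph.Walk.length_map] at this
  refine le_antisymm (key g x y) ?_
  simpa using key g⁻¹ (g * x) (g * y)

/-- A geodesic ray in the Cayley graph, recorded by the vertices it visits: an isometric
embedding of `ℕ` in `G`, with arbitrary starting point. -/
@[ext]
structure GeodesicRay (S : Set G) where
  vertex : ℕ → G
  isGeodesic : ∀ i n : ℕ, (SimpleGraph.mulCayley S).edist (vertex i) (vertex (i + n)) = n

/-- Geodesic rays carry the topology of pointwise convergence (equivalently, of uniform
convergence on bounded sets), `G` being discrete. -/
instance (S : Set G) : TopologicalSpace (GeodesicRay S) :=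
  TopologicalSpace.induced GeodesicRay.vertex (@Pi.topologicalSpace ℕ (fun _ => G) (fun _ => ⊥))

/-- Two geodesic rays are asymptotic when they stay at bounded distance from each other. -/
def geodesicRaySetoid (S : Set G) : Setoid (GeodesicRay S) where
  r r₁ r₂ := ∃ C : ℕ, ∀ n, (SimpleGraph.mulCayley S).edist (r₁.vertex n) (r₂.vertex n) ≤ C
  iseqv :=
    { refl := fun r => ⟨0, fun n => by simp⟩
      symm := by
        rintro r₁ r₂ ⟨C, hC⟩
        exact ⟨C, fun n => by rw [SimpleGraph.edist_comm]; exact hC n⟩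
      trans := by
        rintro r₁ r₂ r₃ ⟨C, hC⟩ ⟨D, hD⟩
        refine ⟨C + D, fun n => ?_⟩
        push_cast
        exact SimpleGraph.edist_triangle.trans (add_le_add (hC n) (hD n)) }

/-- The Gromov boundary of `G`: geodesic rays in the Cayley graph modulo being asymptotic. -/
def GromovBoundary (S : Set G) : Type _ := Quotient (geodesicRaySetoid S)

/-- The quotient topology. For a hyperbolic group this is the usual topology of the boundary: it
agrees with the quotient of the space of rays that start at any one fixed vertex. -/
instance (S : Set G) : TopologicalSpace (GromovBoundary S) :=
  inferInstanceAs (TopologicalSpace (Quotient (geodesicRaySetoid S)))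

/-- The group acts on rays by left translation. -/
instance (S : Set G) : MulAction G (GeodesicRay S) where
  smul g r := ⟨fun n => g * r.vertex n, fun i n => by
    rw [mulCayley_edist_mul_left]; exact r.isGeodesic i n⟩
  one_smul r := by
    ext n
    exact one_mul (r.vertex n)
  mul_smul g h r := by
    ext n
    exact mul_assoc g h (r.vertex n)

theorem GeodesicRay.smul_vertex (S : Set G) (g : G) (r : GeodesicRay S) (n : ℕ) :
    (g • r).vertex n = g * r.vertex n := rfl

/-- The induced action on the boundary. -/
instance (S : Set G) : MulAction G (GromovBoundary S) where
  smul g := Quotient.map (fun r => g • r) (by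
    rintro r₁ r₂ ⟨C, hC⟩
    refine ⟨C, fun n => ?_⟩
    rw [GeodesicRay.smul_vertex, GeodesicRay.smul_vertex, mulCayley_edist_mul_left]
    exact hC n)
  one_smul b := by
    induction b using Quotient.inductionOn with
    | h r => exact congrArg (Quotient.mk _) (one_smul G r)
  mul_smul g h b := by
    induction b using Quotient.inductionOn with
    | h r => exact congrArg (Quotient.mk _) (mul_smul g h r)

/-- The group acts on the boundary by homeomorphisms. -/
instance (S : Set G) : ContinuousConstSMul G (GromovBoundary S) where
  continuous_const_smul g := by
    have h : Continuous (fun r : GeodesicRay S => g • r) := by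
      let : TopologicalSpace G := ⊥
      have : DiscreteTopology G := ⟨rfl⟩
      refine continuous_induced_rng.mpr (continuous_pi fun n => ?_)
      have h1 : Continuous (fun r : GeodesicRay S => r.vertex n) :=
        (continuous_apply n).comp continuous_induced_dom
      exact (continuous_of_discreteTopology (f := fun a : G => g * a)).comp h1
    exact continuous_quot_lift _ (continuous_quot_mk.comp h)

end Hyperbolic

/-- A convergence `Γ`-space, in the weak sense: there is an at most countable family `𝒴` of subsets
of `X` with at most countable intersection, and for each `Y ∈ 𝒴` a sequence in `Γ` that
converges pointwise to one point of `X` on the complement of `Y`. -/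
def IsConvergenceSpace (Γ X : Type*) [Group Γ] [MulAction Γ X] [TopologicalSpace X] : Prop :=
  ∃ 𝒴 : Set (Set X), 𝒴.Countable ∧ (⋂₀ 𝒴).Countable ∧
    ∀ Y ∈ 𝒴, ∃ (γ : ℕ → Γ) (x : X), ∀ y ∉ Y,
      Filter.Tendsto (fun m => γ m • y) Filter.atTop (𝓝 x)

/-! ### Foliated bundles -/

section FoliatedBundle

/-- The group of deck transformations of `p`. -/
def DeckGroup {M B : Type*} [TopologicalSpace M] (p : M → B) : Subgroup (M ≃ₜ M) where
  carrier := {φ | ∀ z, p (φ z) = p z}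
  one_mem' := fun _ => rfl
  mul_mem' := fun {φ ψ} hφ hψ z => (hφ (ψ z)).trans (hψ z)
  inv_mem' := fun {φ} hφ z => by
    have h := hφ (φ⁻¹ z)
    rw [show φ (φ⁻¹ z) = z from φ.apply_symm_apply z] at h
    exact h.symm

variable {M B K : Type*} [TopologicalSpace M] [Group K]

/-- The orbit relation of the diagonal action `γ (z, x) = (γ z, ρ(γ) x)` of the deck group of
`p : M → B` on `M × X`. -/
def foliatedBundleSetoid (p : M → B) (ρ : DeckGroup p →* K) (X : Type*) [MulAction K X] :
    Setoid (M × X) where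
  r a b := ∃ γ : DeckGroup p, b = (γ.1 a.1, ρ γ • a.2)
  iseqv :=
    { refl := fun a => ⟨1, by simp⟩
      symm := by
        rintro ⟨z, x⟩ b ⟨γ, rfl⟩
        refine ⟨γ⁻¹, Prod.ext ?_ ?_⟩
        · exact (γ.1.symm_apply_apply z).symm
        · simp
      trans := by
        rintro ⟨z, x⟩ b c ⟨γ, rfl⟩ ⟨γ', rfl⟩
        refine ⟨γ' * γ, Prod.ext rfl ?_⟩
        simp [mul_smul] }

/-- The foliated bundle `(M × X) / Γ` over `B`, where `p : M → B` is the universal covering and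
`Γ` is its deck group, acting on `X` through `ρ : Γ → K`. -/
def FoliatedBundle (p : M → B) (ρ : DeckGroup p →* K) (X : Type*) [MulAction K X] : Type _ :=
  Quotient (foliatedBundleSetoid p ρ X)

instance (p : M → B) (ρ : DeckGroup p →* K) (X : Type*) [TopologicalSpace X] [MulAction K X] :
    TopologicalSpace (FoliatedBundle p ρ X) :=
  inferInstanceAs (TopologicalSpace (Quotient (foliatedBundleSetoid p ρ X)))

namespace FoliatedBundle

variable (p : M → B) (ρ : DeckGroup p →* K) {X : Type*} [MulAction K X]

/-- The map `M → (M × X) / Γ`, `z ↦ [z, x]`, that uniformizes the leaf through the image of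
`M × {x}`. -/
def leafMap (x : X) (z : M) : FoliatedBundle p ρ X :=
  Quotient.mk (foliatedBundleSetoid p ρ X) (z, x)

/-- The leaves are the images of the slices `M × {x}`. -/
def leaf (x : X) : Set (FoliatedBundle p ρ X) := Set.range (leafMap p ρ x)

variable (E : Type*) [NormedAddCommGroup E] [NormedSpace ℂ E] [ChartedSpace E M]

/-- The function `f` is holomorphic on each leaf. The leaf of `x` is `M` modulo the stabilizer of
`x` in `Γ`, with the complex structure for which `leafMap p ρ x` is a holomorphic covering of it;
so a function on the leaf is holomorphic exactly if its composition with `leafMap p ρ x` is. -/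
def IsLeafwiseHolomorphic (f : FoliatedBundle p ρ X → ℂ) : Prop :=
  ∀ x : X, MDifferentiable 𝓘(ℂ, E) 𝓘(ℂ, ℂ) (fun z => f (leafMap p ρ x z))

/-- The function `f` is constant on each leaf. -/
def IsLeafwiseConstant (f : FoliatedBundle p ρ X → ℂ) : Prop :=
  ∀ x : X, ∀ a ∈ leaf p ρ x, ∀ b ∈ leaf p ρ x, f a = f b

variable (X) in
/-- The foliated bundle is holomorphically plain: every continuous leafwise holomorphic function
on it is leafwise constant. -/
def IsHolomorphicallyPlain [TopologicalSpace X] : Prop :=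
  ∀ f : FoliatedBundle p ρ X → ℂ, Continuous f → IsLeafwiseHolomorphic p ρ E f →
    IsLeafwiseConstant p ρ f

end FoliatedBundle

end FoliatedBundle

/-! Plainness. Lift `f` to a continuous function `F` on `M × X`, holomorphic in `z` and invariant
under the deck group. As base and fiber are compact, its set of values `C ⊆ ℂ` is compact. If a
value `F z₀ x₀` is the point of `C` nearest to some `c ∉ C`, the maximum principle for `1 / (F - c)`
makes the leaf of `x₀` constant. Such values are dense in the frontier of `C`, so the frontier lies
in the closed set `T` of leafwise constants. If `T` is countable, so is `C`, and each leaf has a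
connected countable image, a point (`forall_eq_of_countable_constants`).

Countability of `T`. A constant on the leaf of `y` persists along the holonomy orbit of `y`, hence
equals `F z₀` at the limit of any sequence `γ m • y`. On a convergence space only countably many
limits and countably many exceptional `y` occur (`IsConvergenceSpace.countable_constants`). A
bounded holonomy group is finite, and then the argument runs over one finite orbit instead of the
whole fiber.

Convergence. Let `h m` leave every ball of `G`. Along a subsequence, geodesics from `1` to `h m` and
to `(h m)⁻¹` converge to rays `α` and `β`. A ray not asymptotic to `β` has bounded Gromov products
with `(h m)⁻¹`, so its translate by `h m` runs close to `h m`, hence to `α`, for longer and longer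
times (`exists_subseq_tendsto_smul`). -/

open Filter

/-! ### Word metric, geodesic segments and Gromov products -/

section WordMetric

variable {G : Type*} [Group G] {S : Set G}

theorem mulCayley_connected (hS : Subgroup.closure S = ⊤) : (SimpleGraph.mulCayley S).Connected := by
  have left : ∀ g x y : G, (SimpleGraph.mulCayley S).Reachable x y →
      (SimpleGraph.mulCayley S).Reachable (g * x) (g * y) := fun g x y h => by
    rw [← SimpleGraph.edist_ne_top_iff_reachable] at h ⊢
    rwa [mulCayley_edist_mul_left]
  have one : ∀ g : G, (SimpleGraph.mulCayley S).Reachable 1 g := fun g => by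
    have hg : g ∈ Subgroup.closure S := hS ▸ Subgroup.mem_top g
    induction hg using Subgroup.closure_induction with
    | mem x hx =>
      by_cases h : (1 : G) = x
      · subst h; exact .rfl
      · exact (((SimpleGraph.mulCayley_adj S 1 x).mpr ⟨h, by simp [hx]⟩)).reachable
    | one => exact .rfl
    | mul x y _ _ hx hy => exact hx.trans (by simpa using left x 1 y hy)
    | inv x _ hx =>
      have := left x⁻¹ 1 x hx
      rw [mul_one, inv_mul_cancel] at this
      exact this.symm
  exact ⟨fun x y => (one x).symm.trans (one y)⟩

theorem wordDist_self (x : G) : wordDist S x x = 0 := by simp [wordDist]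

theorem wordDist_nonneg (x y : G) : 0 ≤ wordDist S x y := Nat.cast_nonneg _

theorem wordDist_comm (x y : G) : wordDist S x y = wordDist S y x := by
  simp [wordDist, SimpleGraph.dist_comm]

theorem wordDist_mul_left (g x y : G) : wordDist S (g * x) (g * y) = wordDist S x y := by
  simp only [wordDist, SimpleGraph.dist, mulCayley_edist_mul_left]

theorem wordDist_triangle (hS : Subgroup.closure S = ⊤) (x y z : G) :
    wordDist S x z ≤ wordDist S x y + wordDist S y z := by
  simp only [wordDist]
  exact_mod_cast (mulCayley_connected hS).dist_triangle

theorem edist_eq_natCast_iff (hS : Subgroup.closure S = ⊤) (x y : G) (n : ℕ) :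
    (SimpleGraph.mulCayley S).edist x y = n ↔ wordDist S x y = n := by
  rw [← ((mulCayley_connected hS) x y).coe_dist_eq_edist, wordDist, Nat.cast_inj, Nat.cast_inj]

theorem edist_le_natCast_iff (hS : Subgroup.closure S = ⊤) (x y : G) (n : ℕ) :
    (SimpleGraph.mulCayley S).edist x y ≤ n ↔ wordDist S x y ≤ n := by
  rw [← ((mulCayley_connected hS) x y).coe_dist_eq_edist, wordDist, Nat.cast_le, Nat.cast_le]

theorem eq_mul_of_wordDist_le_one (hS : Subgroup.closure S = ⊤) {x y : G}
    (h : wordDist S x y ≤ 1) : ∃ s ∈ insert 1 (S ∪ S⁻¹), x * s = y := by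
  have h1 : (SimpleGraph.mulCayley S).edist x y ≤ 1 := by
    have := (edist_le_natCast_iff hS x y 1).mpr (by simpa using h)
    simpa using this
  refine ⟨x⁻¹ * y, ?_, by simp⟩
  rcases SimpleGraph.edist_le_one_iff_adj_or_eq.mp h1 with h2 | rfl
  · rcases ((SimpleGraph.mulCayley_adj S x y).mp h2).2 with h3 | h3
    · simp [h3]
    · simp [h3]
  · simp

/-- Finite geodesics from the identity, prolonged by a constant. -/
theorem exists_geodesic_segment (hS : Subgroup.closure S = ⊤) (g : G) :
    ∃ σ : ℕ → G, σ 0 = 1 ∧ (∀ i : ℕ, wordDist S 1 g ≤ i → σ i = g) ∧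
      (∀ i n : ℕ, wordDist S (σ i) (σ (i + n)) ≤ n) ∧
      ∀ i n : ℕ, (i + n : ℝ) ≤ wordDist S 1 g → wordDist S (σ i) (σ (i + n)) = n := by
  obtain ⟨p, hp⟩ := (mulCayley_connected hS).exists_walk_length_eq_dist 1 g
  have hL : wordDist S 1 g = p.length := by rw [wordDist, hp]
  have hend : ∀ i : ℕ, wordDist S 1 g ≤ i → p.getVert i = g := fun i hi =>
    p.getVert_of_length_le (by rw [hL] at hi; exact_mod_cast hi)
  have step : ∀ i : ℕ, wordDist S (p.getVert i) (p.getVert (i + 1)) ≤ 1 := fun i => by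
    by_cases hi : i < p.length
    · have := SimpleGraph.dist_eq_one_iff_adj.mpr (p.adj_getVert_succ hi)
      rw [wordDist, this]; simp
    · push Not at hi
      rw [p.getVert_of_length_le hi, p.getVert_of_length_le (hi.trans (Nat.le_succ i)),
        wordDist_self]
      exact zero_le_one
  have lip : ∀ i n : ℕ, wordDist S (p.getVert i) (p.getVert (i + n)) ≤ n := fun i n => by
    induction n with
    | zero => simp [wordDist_self]
    | succ n ih =>
      have := wordDist_triangle hS (p.getVert i) (p.getVert (i + n)) (p.getVert (i + n + 1))
      have := step (i + n)
      push_cast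
      rw [← add_assoc]
      linarith
  refine ⟨p.getVert, p.getVert_zero, hend, lip, fun i n hin => le_antisymm (lip i n) ?_⟩
  have hin' : i + n ≤ p.length := by rw [hL] at hin; exact_mod_cast hin
  obtain ⟨k, hk⟩ := Nat.exists_eq_add_of_le hin'
  -- The three pieces of the path have at most their nominal lengths, and these add up to the
  -- distance from `1` to `g`; so the middle piece cannot be shorter.
  have h1 := lip 0 i
  have h2 := lip (i + n) k
  have h3 := wordDist_triangle hS 1 (p.getVert i) (p.getVert (i + n))
  have h4 := wordDist_triangle hS 1 (p.getVert (i + n)) g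
  rw [← hk, p.getVert_length] at h2
  rw [zero_add, p.getVert_zero] at h1
  have hk' : (p.length : ℝ) = i + n + k := by exact_mod_cast hk
  linarith

/-- By induction on the radius: the vertex before the last on a geodesic lies in the smaller ball,
and the last step is one of finitely many letters. -/
theorem finite_wordDist_le (hS : Subgroup.closure S = ⊤) (hfin : S.Finite) (n : ℕ) :
    {g : G | wordDist S 1 g ≤ n}.Finite := by
  induction n with
  | zero =>
    refine (Set.finite_singleton (1 : G)).subset fun g hg => ?_
    have hg' : (SimpleGraph.mulCayley S).edist 1 g ≤ (0 : ℕ) :=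
      (edist_le_natCast_iff hS 1 g 0).mpr hg
    simp only [Nat.cast_zero, nonpos_iff_eq_zero, SimpleGraph.edist_eq_zero_iff] at hg'
    exact hg'.symm
  | succ n ih =>
    have hT : (insert 1 (S ∪ S⁻¹) : Set G).Finite := (hfin.union hfin.inv).insert 1
    refine (Set.Finite.image2 (fun a b => a * b) ih hT).subset fun g hg => ?_
    obtain ⟨σ, h0, h1, h2, -⟩ := exists_geodesic_segment hS g
    have hσ := h2 n 1
    rw [h1 (n + 1) hg] at hσ
    obtain ⟨s, hs, hsg⟩ := eq_mul_of_wordDist_le_one hS (by simpa using hσ)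
    refine ⟨σ n, ?_, s, hs, hsg⟩
    have := h2 0 n
    rwa [h0, zero_add] at this

theorem gromovProduct_comm (w x y : G) : gromovProduct S w x y = gromovProduct S w y x := by
  rw [gromovProduct, gromovProduct, wordDist_comm x y, add_comm (wordDist S x w)]

/-- Balls being finite, sequences of maps `ℕ → G` of at most linear growth have pointwise
convergent subsequences. -/
theorem exists_subseq_eventually_eq (hS : Subgroup.closure S = ⊤) (hfin : S.Finite)
    (σ : ℕ → ℕ → G) (hσ : ∀ m k : ℕ, wordDist S 1 (σ m k) ≤ k) :
    ∃ (τ : ℕ → G) (φ : ℕ → ℕ), StrictMono φ ∧ ∀ k, ∀ᶠ m in atTop, σ (φ m) k = τ k := by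
  let : TopologicalSpace G := ⊥
  have : DiscreteTopology G := ⟨rfl⟩
  have hK : IsCompact (Set.univ.pi fun k : ℕ => {g : G | wordDist S 1 g ≤ k}) :=
    isCompact_univ_pi fun k => (finite_wordDist_le hS hfin k).isCompact
  obtain ⟨τ, -, φ, hφ, h⟩ := hK.tendsto_subseq (x := σ) fun m k _ => hσ m k
  refine ⟨τ, φ, hφ, fun k => ?_⟩
  have := tendsto_pi_nhds.mp h k
  rwa [nhds_discrete, tendsto_pure] at this

/-- The hyperbolicity inequality along a chain of four points. -/
theorem le_gromovProduct_of_chain {δ a : ℝ} (hδ : ∀ w x y z : G,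
      min (gromovProduct S w x y) (gromovProduct S w y z) - δ ≤ gromovProduct S w x z)
    {w x₀ x₁ x₂ x₃ : G} (h₁ : a ≤ gromovProduct S w x₀ x₁) (h₂ : a ≤ gromovProduct S w x₁ x₂)
    (h₃ : a ≤ gromovProduct S w x₂ x₃) : a - 2 * δ ≤ gromovProduct S w x₀ x₃ := by
  -- This instance says `0 ≤ δ`, needed to weaken the third bound from `a` to `a - δ`.
  have h0 := hδ w w w w
  simp only [gromovProduct, wordDist_self] at h0
  have h4 := (sub_le_sub_right (le_min h₁ h₂) δ).trans (hδ w x₀ x₁ x₂)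
  have h5 : a - δ ≤ gromovProduct S w x₂ x₃ := by norm_num at h0; linarith
  have := (sub_le_sub_right (le_min h4 h5) δ).trans (hδ w x₀ x₂ x₃)
  linarith

theorem wordDist_le_of_le_gromovProduct {w x y : G} {k a : ℝ} (hx : wordDist S w x = k)
    (hy : wordDist S w y = k) (h : k - a ≤ gromovProduct S w x y) : wordDist S x y ≤ 2 * a := by
  rw [gromovProduct, wordDist_comm x w, wordDist_comm y w] at h
  linarith

end WordMetric

/-! ### Geodesic rays and compactness of the boundary -/

section Rays

variable {G : Type*} [Group G] {S : Set G}

theorem GeodesicRay.wordDist_vertex (hS : Subgroup.closure S = ⊤) (r : GeodesicRay S) (i n : ℕ) :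
    wordDist S (r.vertex i) (r.vertex (i + n)) = n :=
  (edist_eq_natCast_iff hS _ _ _).mp (r.isGeodesic i n)

theorem GeodesicRay.wordDist_one_vertex (hS : Subgroup.closure S = ⊤) {r : GeodesicRay S}
    (h0 : r.vertex 0 = 1) (n : ℕ) : wordDist S 1 (r.vertex n) = n := by
  simpa [h0] using r.wordDist_vertex hS 0 n

theorem GeodesicRay.gromovProduct_vertex (hS : Subgroup.closure S = ⊤) {r : GeodesicRay S}
    (h0 : r.vertex 0 = 1) (i n : ℕ) :
    gromovProduct S 1 (r.vertex i) (r.vertex (i + n)) = i := by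
  rw [gromovProduct, r.wordDist_vertex hS, wordDist_comm _ 1, wordDist_comm _ 1,
    wordDist_one_vertex hS h0, wordDist_one_vertex hS h0]
  push_cast
  ring

theorem geodesicRaySetoid_iff (hS : Subgroup.closure S = ⊤) (r s : GeodesicRay S) :
    geodesicRaySetoid S r s ↔ ∃ C : ℝ, ∀ n, wordDist S (r.vertex n) (s.vertex n) ≤ C := by
  constructor
  · rintro ⟨C, hC⟩
    exact ⟨C, fun n => (edist_le_natCast_iff hS _ _ C).mp (hC n)⟩
  · rintro ⟨C, hC⟩
    obtain ⟨D, hD⟩ := exists_nat_ge C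
    exact ⟨D, fun n => (edist_le_natCast_iff hS _ _ D).mpr ((hC n).trans hD)⟩

/-- Limits of geodesic segments whose lengths tend to infinity are geodesic rays. -/
theorem exists_geodesicRay_of_eventually_eq (hS : Subgroup.closure S = ⊤) {g : ℕ → G}
    (hg : Tendsto (fun m => wordDist S 1 (g m)) atTop atTop) {σ : ℕ → ℕ → G} {τ : ℕ → G}
    (hσ : ∀ m i n : ℕ, (i + n : ℝ) ≤ wordDist S 1 (g m) →
      wordDist S (σ m i) (σ m (i + n)) = n)
    (h : ∀ k, ∀ᶠ m in atTop, σ m k = τ k) : ∃ r : GeodesicRay S, r.vertex = τ := by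
  refine ⟨⟨τ, fun i n => (edist_eq_natCast_iff hS _ _ _).mpr ?_⟩, rfl⟩
  obtain ⟨m, h1, h2, h3⟩ := ((h i).and ((h (i + n)).and
    (hg.eventually_ge_atTop (i + n : ℝ)))).exists
  rw [← h1, ← h2]
  exact hσ m i n h3

/-- Every unbounded sequence in `G` has a subsequence with geodesics from the identity that
converge to a ray. -/
theorem exists_subseq_geodesics (hS : Subgroup.closure S = ⊤) (hfin : S.Finite) {g : ℕ → G}
    (hg : Tendsto (fun m => wordDist S 1 (g m)) atTop atTop) :
    ∃ (r : GeodesicRay S) (φ : ℕ → ℕ), r.vertex 0 = 1 ∧ StrictMono φ ∧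
      ∀ k : ℕ, ∀ᶠ m in atTop, (k : ℝ) ≤ gromovProduct S 1 (r.vertex k) (g (φ m)) ∧
        wordDist S (r.vertex k) (g (φ m)) = wordDist S 1 (g (φ m)) - k := by
  choose σ h0 hend hlip hgeo using fun m => exists_geodesic_segment hS (g m)
  obtain ⟨τ, φ, hφ, hτ⟩ := exists_subseq_eventually_eq hS hfin σ fun m k => by
    simpa [h0] using hlip m 0 k
  have hgφ := hg.comp hφ.tendsto_atTop
  obtain ⟨r, rfl⟩ := exists_geodesicRay_of_eventually_eq hS hgφ (σ := fun m => σ (φ m))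
    (fun m => hgeo (φ m)) hτ
  have hr0 : r.vertex 0 = 1 := by
    obtain ⟨m, hm⟩ := (hτ 0).exists
    rw [← hm, h0]
  refine ⟨r, φ, hr0, hφ, fun k => ?_⟩
  filter_upwards [hτ k, hgφ.eventually_ge_atTop (k : ℝ)] with m h1 h2
  simp only [Function.comp_apply] at h2
  have key : wordDist S (r.vertex k) (g (φ m)) = wordDist S 1 (g (φ m)) - k := by
    rw [← h1]
    obtain ⟨L, hL⟩ : ∃ L : ℕ, wordDist S 1 (g (φ m)) = L := ⟨_, rfl⟩
    have hkL : k ≤ L := by rw [hL] at h2; exact_mod_cast h2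
    obtain ⟨n, rfl⟩ := Nat.exists_eq_add_of_le hkL
    have := hgeo (φ m) k n (by rw [hL]; push_cast; rfl)
    rw [hend (φ m) (k + n) hL.le] at this
    rw [this, hL]
    push_cast
    ring
  refine ⟨?_, key⟩
  rw [gromovProduct, key, wordDist_comm _ 1, wordDist_comm _ 1, r.wordDist_one_vertex hS hr0]
  linarith

/-- Every ray is asymptotic to a ray from the identity. -/
theorem exists_geodesicRay_from_one (hS : IsHyperbolicGeneratingSet S) (r : GeodesicRay S) :
    ∃ s : GeodesicRay S, s.vertex 0 = 1 ∧ geodesicRaySetoid S s r := by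
  have hc := hS.closure_eq_top
  obtain ⟨δ, hδ⟩ := hS.hyperbolic
  set D := wordDist S 1 (r.vertex 0) with hD
  have hr : ∀ n : ℕ, n - D ≤ wordDist S 1 (r.vertex n) ∧ wordDist S 1 (r.vertex n) ≤ n + D :=
    fun n => by
      have h1 := wordDist_triangle hc 1 (r.vertex 0) (r.vertex n)
      have h2 := wordDist_triangle hc (r.vertex 0) 1 (r.vertex n)
      have h3 := r.wordDist_vertex hc 0 n
      rw [wordDist_comm _ 1] at h2
      rw [zero_add] at h3
      exact ⟨by linarith, by linarith⟩
  have hlim : Tendsto (fun m => wordDist S 1 (r.vertex m)) atTop atTop :=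
    tendsto_atTop_mono (fun n => (hr n).1)
      (tendsto_atTop_add_const_right _ (-D) tendsto_natCast_atTop_atTop)
  obtain ⟨s, φ, hs0, hφ, hs⟩ := exists_subseq_geodesics hc hS.finite hlim
  -- Through a far vertex of `r`, the product of `s.vertex k` and `r.vertex k` is at least `k - D -
  -- δ`, while their norms are `k` and at most `k + D`.
  refine ⟨s, hs0, (geodesicRaySetoid_iff hc s r).mpr ⟨3 * D + 2 * δ, fun k => ?_⟩⟩
  obtain ⟨m, ⟨hm, -⟩, hkm⟩ := ((hs k).and (hφ.tendsto_atTop.eventually_ge_atTop k)).exists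
  obtain ⟨n, hn⟩ := Nat.exists_eq_add_of_le hkm
  have h1 := r.wordDist_vertex hc k n
  rw [← hn] at h1
  have hφm : (φ m : ℝ) = k + n := by exact_mod_cast hn
  have h2 : k - D ≤ gromovProduct S 1 (r.vertex (φ m)) (r.vertex k) := by
    rw [gromovProduct, wordDist_comm _ (r.vertex k), h1, wordDist_comm _ 1, wordDist_comm _ 1]
    have := (hr k).1
    have := (hr (φ m)).1
    linarith
  have hD0 : 0 ≤ D := wordDist_nonneg _ _
  have h3 := (sub_le_sub_right (le_min (by linarith : (k : ℝ) - D ≤ _) h2) δ).trans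
    (hδ 1 (s.vertex k) (r.vertex (φ m)) (r.vertex k))
  rw [gromovProduct, wordDist_comm _ 1, wordDist_comm _ 1, s.wordDist_one_vertex hc hs0] at h3
  have := (hr k).2
  linarith

theorem GeodesicRay.tendsto_nhds_iff {ι : Type*} {l : Filter ι} {r : ι → GeodesicRay S}
    {s : GeodesicRay S} :
    Tendsto r l (𝓝 s) ↔ ∀ k, ∀ᶠ i in l, (r i).vertex k = s.vertex k := by
  let : TopologicalSpace G := ⊥
  have : DiscreteTopology G := ⟨rfl⟩
  have h : Topology.IsInducing (GeodesicRay.vertex : GeodesicRay S → ℕ → G) := ⟨rfl⟩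
  rw [h.tendsto_nhds_iff, tendsto_pi_nhds]
  refine forall_congr' fun k => ?_
  rw [nhds_discrete, tendsto_pure]
  rfl

theorem exists_subseq_tendsto_geodesicRay (hc : Subgroup.closure S = ⊤) (hfin : S.Finite)
    (r : ℕ → GeodesicRay S) (hr : ∀ m, (r m).vertex 0 = 1) :
    ∃ s : GeodesicRay S, s.vertex 0 = 1 ∧ ∃ φ : ℕ → ℕ, StrictMono φ ∧
      Tendsto (r ∘ φ) atTop (𝓝 s) := by
  obtain ⟨τ, φ, hφ, h⟩ := exists_subseq_eventually_eq hc hfin (fun m => (r m).vertex)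
    fun m k => ((r m).wordDist_one_vertex hc (hr m) k).le
  refine ⟨⟨τ, fun i n => ?_⟩, ?_, φ, hφ, GeodesicRay.tendsto_nhds_iff.mpr h⟩
  · obtain ⟨m, h1, h2⟩ := ((h i).and (h (i + n))).exists
    rw [← h1, ← h2]
    exact (r (φ m)).isGeodesic i n
  · obtain ⟨m, hm⟩ := (h 0).exists
    exact hm.symm.trans (hr _)

/-- The rays form a closed subset of a product of finite balls: each condition involves only
finitely many vertices. -/
theorem isCompact_geodesicRay_from_one (hc : Subgroup.closure S = ⊤) (hfin : S.Finite) :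
    IsCompact {r : GeodesicRay S | r.vertex 0 = 1} := by
  let : TopologicalSpace G := ⊥
  have : DiscreteTopology G := ⟨rfl⟩
  have h : Topology.IsInducing (GeodesicRay.vertex : GeodesicRay S → ℕ → G) := ⟨rfl⟩
  rw [h.isCompact_iff]
  have hK : IsCompact (Set.univ.pi fun k : ℕ => {g : G | wordDist S 1 g ≤ k}) :=
    isCompact_univ_pi fun k => (finite_wordDist_le hc hfin k).isCompact
  refine hK.of_isClosed_subset ?_ ?_
  · have : GeodesicRay.vertex '' {r : GeodesicRay S | r.vertex 0 = 1} =
        {σ : ℕ → G | σ 0 = 1} ∩ ⋂ (i : ℕ) (n : ℕ),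
          {σ : ℕ → G | (SimpleGraph.mulCayley S).edist (σ i) (σ (i + n)) = n} := by
      ext σ
      simp only [Set.mem_image, Set.mem_ofPred_eq, Set.mem_inter_iff, Set.mem_iInter]
      constructor
      · rintro ⟨r, hr, rfl⟩
        exact ⟨hr, r.isGeodesic⟩
      · rintro ⟨h0, hσ⟩
        exact ⟨⟨σ, hσ⟩, h0, rfl⟩
    rw [this]
    have cont : ∀ i : ℕ, Continuous fun σ : ℕ → G => σ i := fun i => continuous_apply i
    refine IsClosed.inter ?_ (isClosed_iInter fun i => isClosed_iInter fun n => ?_)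
    · exact (isClosed_discrete ({1} : Set G)).preimage (cont 0)
    · exact (isClosed_discrete
        {q : G × G | (SimpleGraph.mulCayley S).edist q.1 q.2 = n}).preimage
        ((cont i).prodMk (cont (i + n)))
  · rintro _ ⟨r, hr, rfl⟩ k -
    exact (r.wordDist_one_vertex hc hr k).le

theorem exists_mk_eq_from_one (hS : IsHyperbolicGeneratingSet S) (y : GromovBoundary S) :
    ∃ r : GeodesicRay S, r.vertex 0 = 1 ∧ (Quotient.mk (geodesicRaySetoid S) r) = y := by
  induction y using Quotient.inductionOn with
  | h r =>
    obtain ⟨s, hs0, hs⟩ := exists_geodesicRay_from_one hS r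
    exact ⟨s, hs0, Quotient.sound hs⟩

theorem compactSpace_gromovBoundary (hS : IsHyperbolicGeneratingSet S) :
    CompactSpace (GromovBoundary S) := by
  have h := (isCompact_geodesicRay_from_one hS.closure_eq_top hS.finite).image
    (f := (Quotient.mk (geodesicRaySetoid S) : GeodesicRay S → GromovBoundary S))
    continuous_quot_mk
  refine ⟨h.of_isClosed_subset isClosed_univ fun y _ => ?_⟩
  obtain ⟨r, hr, hy⟩ := exists_mk_eq_from_one hS y
  exact ⟨r, hr, hy⟩

end Rays

/-! ### Convergence dynamics on the boundary -/

section BoundaryDynamics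

variable {G : Type*} [Group G] {S : Set G}

/-- If the Gromov products of a ray `r` with a sequence converging to the endpoint of a ray `s` are
not eventually bounded, then `r` and `s` are asymptotic. -/
theorem geodesicRaySetoid_of_frequently (hS : IsHyperbolicGeneratingSet S) {r s : GeodesicRay S}
    (hr : r.vertex 0 = 1) (hs : s.vertex 0 = 1) {g : ℕ → G}
    (hsg : ∀ k : ℕ, ∀ᶠ m in atTop, (k : ℝ) ≤ gromovProduct S 1 (s.vertex k) (g m))
    (h : ∀ k : ℕ, ∃ᶠ m in atTop, ∃ n, (k : ℝ) ≤ gromovProduct S 1 (r.vertex n) (g m)) :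
    geodesicRaySetoid S r s := by
  have hc := hS.closure_eq_top
  obtain ⟨δ, hδ⟩ := hS.hyperbolic
  refine (geodesicRaySetoid_iff hc r s).mpr ⟨2 * (2 * δ), fun k => ?_⟩
  obtain ⟨m, ⟨n, hn⟩, hm⟩ := ((h k).and_eventually (hsg k)).exists
  -- A Gromov product is at most the norm of either point. So `r.vertex k` precedes `r.vertex n`,
  -- and all products in the chain `r.vertex k`, `r.vertex n`, `g m`, `s.vertex k` are at least `k`.
  have hkn : k ≤ n := by
    have h1 := wordDist_triangle hc 1 (r.vertex n) (g m)
    have h2 := r.wordDist_one_vertex hc hr n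
    rw [gromovProduct, wordDist_comm _ 1, wordDist_comm (g m) 1] at hn
    exact_mod_cast (by linarith : (k : ℝ) ≤ n)
  obtain ⟨j, rfl⟩ := Nat.exists_eq_add_of_le hkn
  refine wordDist_le_of_le_gromovProduct (r.wordDist_one_vertex hc hr k)
    (s.wordDist_one_vertex hc hs k) ?_
  refine le_gromovProduct_of_chain hδ (r.gromovProduct_vertex hc hr k j).ge hn ?_
  rw [gromovProduct_comm]
  exact hm

/-- Left invariance turns distances from `1` into distances from `h⁻¹`. Thus a ray that diverges
early from `h⁻¹` has a translate that follows `h` almost to its full length. -/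
theorem gromovProduct_mul_left (hc : Subgroup.closure S = ⊤) {r : GeodesicRay S}
    (hr : r.vertex 0 = 1) (h : G) (n : ℕ) :
    gromovProduct S 1 (h * r.vertex n) h =
      wordDist S 1 h - gromovProduct S 1 (r.vertex n) h⁻¹ := by
  have h1 : wordDist S (h * r.vertex n) 1 = wordDist S (r.vertex n) h⁻¹ := by
    rw [← wordDist_mul_left h (r.vertex n) h⁻¹, mul_inv_cancel]
  have h2 : wordDist S h⁻¹ 1 = wordDist S 1 h := by
    rw [← wordDist_mul_left h h⁻¹ 1, mul_inv_cancel, mul_one]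
  have h3 : wordDist S (h * r.vertex n) h = n := by
    have := wordDist_mul_left (S := S) h (r.vertex n) 1
    rwa [mul_one, wordDist_comm (r.vertex n), r.wordDist_one_vertex hc hr] at this
  rw [gromovProduct, gromovProduct, h1, h2, h3, wordDist_comm (r.vertex n) 1,
    r.wordDist_one_vertex hc hr, wordDist_comm h 1]
  ring

/-- A ray from `1` asymptotic to the translate `h r` of a ray from `1` is close to `h` as long as
`r` is far from `h⁻¹`. -/
theorem le_gromovProduct_of_asymptotic_smul (hc : Subgroup.closure S = ⊤) {δ : ℝ}
    (hδ : ∀ w x y z : G,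
      min (gromovProduct S w x y) (gromovProduct S w y z) - δ ≤ gromovProduct S w x z)
    {r s : GeodesicRay S} (hr : r.vertex 0 = 1) (hs : s.vertex 0 = 1) {h : G}
    (hsr : geodesicRaySetoid S s (h • r)) {c : ℝ}
    (hrh : ∀ n, gromovProduct S 1 (r.vertex n) h⁻¹ ≤ c) (N : ℕ) :
    ∃ n, N ≤ n ∧ wordDist S 1 h - c - δ ≤ gromovProduct S 1 (s.vertex n) h := by
  obtain ⟨C, hC⟩ := (geodesicRaySetoid_iff hc _ _).mp hsr
  -- The constant `C` depends on `h`, but it affects only how large `n` must be. Beyond this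
  -- threshold the product of `s.vertex n` and `h * r.vertex n` is at least `wordDist S 1 h - c`.
  obtain ⟨N', hN'⟩ := exists_nat_ge ((3 * wordDist S 1 h + C) / 2 - c)
  refine ⟨max N N', le_max_left _ _, ?_⟩
  set n := max N N'
  have hn : ((3 * wordDist S 1 h + C) / 2 - c) ≤ n :=
    hN'.trans (by exact_mod_cast le_max_right N N')
  have h1 := hC n
  rw [GeodesicRay.smul_vertex] at h1
  have h2 : wordDist S 1 h - c ≤ gromovProduct S 1 (s.vertex n) (h * r.vertex n) := by
    have h3 := wordDist_triangle hc h 1 (h * r.vertex n)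
    have h4 := wordDist_mul_left (S := S) h 1 (r.vertex n)
    rw [mul_one, r.wordDist_one_vertex hc hr] at h4
    rw [gromovProduct, wordDist_comm _ 1, wordDist_comm _ 1, s.wordDist_one_vertex hc hs]
    rw [wordDist_comm h 1] at h3
    linarith
  have h3 : wordDist S 1 h - c ≤ gromovProduct S 1 (h * r.vertex n) h := by
    rw [gromovProduct_mul_left hc hr]
    linarith [hrh n]
  exact (sub_le_sub_right (le_min h2 h3) δ).trans (hδ _ _ _ _)

/-- The convergence property of the action on the boundary. -/
theorem exists_subseq_tendsto_smul (hS : IsHyperbolicGeneratingSet S) {h : ℕ → G}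
    (hh : Tendsto (fun m => wordDist S 1 (h m)) atTop atTop) :
    ∃ (φ : ℕ → ℕ) (a b : GromovBoundary S), StrictMono φ ∧
      ∀ y, y ≠ b → Tendsto (fun m => h (φ m) • y) atTop (𝓝 a) := by
  have hc := hS.closure_eq_top
  obtain ⟨δ, hδ⟩ := hS.hyperbolic
  obtain ⟨α, φ₁, hα, hφ₁, hαh⟩ := exists_subseq_geodesics hc hS.finite hh
  have hinv : ∀ g : G, wordDist S 1 g⁻¹ = wordDist S 1 g := fun g => by
    rw [← wordDist_mul_left g 1 g⁻¹, mul_one, mul_inv_cancel, wordDist_comm]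
  have hh' : Tendsto (fun m => wordDist S 1 (h (φ₁ m))⁻¹) atTop atTop := by
    simp only [hinv]
    exact hh.comp hφ₁.tendsto_atTop
  obtain ⟨β, φ₂, hβ, hφ₂, hβh⟩ := exists_subseq_geodesics hc hS.finite hh'
  refine ⟨φ₁ ∘ φ₂, Quotient.mk _ α, Quotient.mk _ β, hφ₁.comp hφ₂, fun y hy => ?_⟩
  obtain ⟨r, hr, rfl⟩ := exists_mk_eq_from_one hS y
  have hfar : ∃ k : ℕ, ∀ᶠ m in atTop, ∀ n,
      gromovProduct S 1 (r.vertex n) (h (φ₁ (φ₂ m)))⁻¹ ≤ k := by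
    by_contra! hcon
    refine hy (Quotient.sound (geodesicRaySetoid_of_frequently hS hr hβ
      (fun k => (hβh k).mono fun m hm => hm.1) fun k => ?_))
    exact (hcon k).mono fun m ⟨n, hn⟩ => ⟨n, hn.le⟩
  obtain ⟨c, hfar⟩ := hfar
  choose s hs hsm using fun m => exists_geodesicRay_from_one hS (h (φ₁ (φ₂ m)) • r)
  suffices hlim : Tendsto (fun m => (Quotient.mk (geodesicRaySetoid S) (s m) : GromovBoundary S))
      atTop (𝓝 (Quotient.mk _ α)) from hlim.congr fun m => Quotient.sound (hsm m)
  -- By compactness every subsequence of the `s m` has a further subsequence converging to a ray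
  -- `t`; it suffices that `t` is always asymptotic to `α`.
  refine tendsto_of_subseq_tendsto fun ns hns => ?_
  obtain ⟨t, ht, ψ, hψ, hst⟩ := exists_subseq_tendsto_geodesicRay hc hS.finite (s ∘ ns)
    fun m => hs _
  refine ⟨ψ, ?_⟩
  have hmkc : Continuous (Quotient.mk (geodesicRaySetoid S) : _ → GromovBoundary S) :=
    continuous_quot_mk
  have hta : (Quotient.mk (geodesicRaySetoid S) t) = Quotient.mk _ α := by
    refine Quotient.sound ((geodesicRaySetoid_iff hc t α).mpr ⟨2 * (2 * δ), fun k => ?_⟩)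
    have hu : Tendsto (fun m => ns (ψ m)) atTop atTop := hns.comp hψ.tendsto_atTop
    -- Once the norm of the group element exceeds `k + c + δ`, the chain `s k`, `s n`, `h`, `α k`
    -- has all its products at least `k`.
    have hlen := (hh.comp (hφ₁.comp hφ₂).tendsto_atTop).comp hu
    obtain ⟨m, h1, h2, h3, h4⟩ := ((GeodesicRay.tendsto_nhds_iff.mp hst k).and
      ((hu.eventually hfar).and
        ((hlen.eventually_ge_atTop (k + c + δ : ℝ)).and
          ((hφ₂.tendsto_atTop.comp hu).eventually (hαh k))))).exists
    simp only [Function.comp_apply] at h1 h3 h4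
    obtain ⟨n, hkn, hn⟩ := le_gromovProduct_of_asymptotic_smul hc hδ hr (hs _) (hsm _) h2 k
    obtain ⟨j, rfl⟩ := Nat.exists_eq_add_of_le hkn
    refine wordDist_le_of_le_gromovProduct (t.wordDist_one_vertex hc ht k)
      (α.wordDist_one_vertex hc hα k) ?_
    rw [← h1]
    refine le_gromovProduct_of_chain hδ ((s _).gromovProduct_vertex hc (hs _) k j).ge
      (by linarith) ?_
    rw [gromovProduct_comm]
    exact h4.1
  exact hta ▸ (hmkc.tendsto t).comp hst

theorem isConvergenceSpace_of_isUnboundedSubgroup (hS : IsHyperbolicGeneratingSet S)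
    {H : Subgroup G} (hH : IsUnboundedSubgroup S H) : IsConvergenceSpace H (GromovBoundary S) := by
  choose h hhH hh using fun m : ℕ => hH m
  obtain ⟨φ, a, b, -, hab⟩ := exists_subseq_tendsto_smul hS
    (tendsto_atTop_mono (fun m => (hh m).le) tendsto_natCast_atTop_atTop)
  refine ⟨{{b}}, Set.countable_singleton _, by simp, ?_⟩
  rintro _ rfl
  exact ⟨fun m => ⟨h (φ m), hhH _⟩, a, fun y hy => hab y hy⟩

/-- Bounded subgroups are finite. -/
theorem finite_of_not_isUnboundedSubgroup (hS : IsHyperbolicGeneratingSet S)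
    {H : Subgroup G} (hH : ¬ IsUnboundedSubgroup S H) : (H : Set G).Finite := by
  simp only [IsUnboundedSubgroup, not_forall, not_exists, not_and, not_lt] at hH
  obtain ⟨C, hC⟩ := hH
  obtain ⟨n, hn⟩ := exists_nat_ge C
  exact (finite_wordDist_le hS.closure_eq_top hS.finite n).subset fun h hh => (hC h hh).trans hn

end BoundaryDynamics

/-! ### Compact plane sets with countable frontier -/

section Plane

/-- A compact subset of the plane with countable frontier is countable. -/
theorem countable_of_countable_frontier {C : Set ℂ} (hC : IsCompact C)
    (h : (frontier C).Countable) : C.Countable := by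
  have hconn : IsConnected (frontier C)ᶜ :=
    h.isConnected_compl_of_one_lt_rank (by rw [Complex.rank_real_complex]; norm_num)
  -- Otherwise the interior and the complement of `C` would separate the connected complement of the
  -- frontier.
  have hint : interior C = ∅ := by
    by_contra hne
    obtain ⟨z, hz⟩ := Set.nonempty_iff_ne_empty.mpr hne
    obtain ⟨w, hw⟩ : (Cᶜ).Nonempty := by
      rw [Set.nonempty_compl]
      rintro rfl
      exact noncompact_univ ℂ hC
    have hsub : (frontier C)ᶜ ⊆ interior C ∪ Cᶜ := fun x hx => by
      rw [hC.isClosed.frontier_eq] at hx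
      by_cases hxC : x ∈ C
      · exact Or.inl (by_contra fun hi => hx ⟨hxC, hi⟩)
      · exact Or.inr hxC
    obtain ⟨x, -, hx1, hx2⟩ := hconn.isPreconnected _ _ isOpen_interior hC.isClosed.isOpen_compl hsub
      ⟨z, fun hf => hf.2 hz, hz⟩ ⟨w, fun hf => hw (hC.isClosed.frontier_subset hf), hw⟩
    exact hx2 (interior_subset hx1)
  rw [hC.isClosed.frontier_eq, hint, Set.sdiff_empty] at h
  exact h

end Plane

/-! ### Deck transformations and compact fundamental sets -/

section Covering

variable {M B : Type*} [TopologicalSpace M] [TopologicalSpace B] {p : M → B}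

/-- The deck group of the universal covering acts transitively on fibers. -/
theorem IsCoveringMap.exists_deckGroup_apply_eq [SimplyConnectedSpace M]
    [LocallyPathConnectedSpace M] (hp : IsCoveringMap p) {z z' : M} (h : p z = p z') :
    ∃ γ : DeckGroup p, γ.1 z = z' := by
  have key : ∀ z z' : M, p z = p z' → ∃ F : C(M, M), F z = z' ∧ p ∘ F = p := fun z z' h => by
    obtain ⟨F, hF, -⟩ := hp.existsUnique_continuousMap_lifts ⟨p, hp.continuous⟩ z z' h.symm
    exact ⟨F, hF⟩
  -- `F' ∘ F` and the identity are lifts of `p` that agree at `z`, so they coincide.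
  have inv : ∀ (z : M) (F F' : C(M, M)), F' (F z) = z → p ∘ F = p → p ∘ F' = p →
      ∀ x, F' (F x) = x := fun z F F' hz hF hF' x => by
    refine congrFun (hp.eq_of_comp_eq (F'.continuous.comp F.continuous) continuous_id ?_ z hz) x
    rw [← Function.comp_assoc, hF', hF, Function.comp_id]
  obtain ⟨F, hFz, hF⟩ := key z z' h
  obtain ⟨F', hFz', hF'⟩ := key z' z h.symm
  exact ⟨⟨⟨⟨F, F', inv z F F' (by rw [hFz, hFz']) hF hF', inv z' F' F (by rw [hFz', hFz]) hF' hF⟩,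
    F.continuous, F'.continuous⟩, congrFun hF⟩, hFz⟩

theorem IsCoveringMap.surjective_of_pathConnectedSpace [Nonempty M] [PathConnectedSpace B]
    (hp : IsCoveringMap p) : Function.Surjective p := fun b => by
  obtain ⟨z⟩ := ‹Nonempty M›
  let q := PathConnectedSpace.somePath (p z) b
  obtain ⟨Q, hQ, -⟩ := hp.exists_path_lifts q.toContinuousMap z q.source
  exact ⟨Q 1, (congrFun hQ 1).trans q.target⟩

theorem IsOpenMap.exists_isCompact_image_eq_univ [LocallyCompactSpace M] [CompactSpace B]
    (hp : IsOpenMap p) (hs : Function.Surjective p) : ∃ K : Set M, IsCompact K ∧ p '' K = Set.univ := by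
  choose z hz using hs
  choose N hN hzN using fun b => exists_compact_mem_nhds (z b)
  obtain ⟨t, -, ht⟩ := isCompact_univ.elim_nhds_subcover (fun b => p '' N b) fun b _ => by
    have := hp.image_mem_nhds (hzN b)
    rwa [hz b] at this
  refine ⟨⋃ b ∈ t, N b, t.isCompact_biUnion fun b _ => hN b, ?_⟩
  rw [Set.image_iUnion₂]
  exact Set.univ_subset_iff.mp ht

end Covering

/-! ### Maximum principle and leafwise constants -/

section MaximumPrinciple

variable {E : Type*} [NormedAddCommGroup E] [NormedSpace ℂ E]
  {M : Type*} [TopologicalSpace M] [ChartedSpace E M] [IsManifold 𝓘(ℂ, E) ω M]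
  {X : Type*} [TopologicalSpace X]

/-- A holomorphic function that comes closest to an omitted value is constant. -/
theorem MDifferentiable.eq_of_forall_dist_le [PreconnectedSpace M] {u : M → ℂ}
    (hu : MDifferentiable 𝓘(ℂ, E) 𝓘(ℂ, ℂ) u) {c : ℂ} {z₀ : M} (hc : ∀ z, u z ≠ c)
    (h : ∀ z, dist (u z₀) c ≤ dist (u z) c) (z : M) : u z = u z₀ := by
  have hne : ∀ z, u z - c ≠ 0 := fun z => sub_ne_zero.mpr (hc z)
  have hg : MDifferentiable 𝓘(ℂ, E) 𝓘(ℂ, ℂ) (fun z => (u z - c)⁻¹) := fun z => by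
    have h1 : DifferentiableAt ℂ (fun w : ℂ => (w - c)⁻¹) (u z) :=
      (differentiableAt_id.sub_const c).inv (hne z)
    exact h1.mdifferentiableAt.comp z (hu z)
  have : IsManifold 𝓘(ℂ, E) 1 M := IsManifold.of_le (n := ω) le_top
  have hmax : IsMaxOn (norm ∘ fun z => (u z - c)⁻¹) Set.univ z₀ := fun z _ => by
    simp only [Set.mem_ofPred_eq, Function.comp_apply, norm_inv]
    refine inv_anti₀ (norm_pos_iff.mpr (hne z₀)) ?_
    simpa [dist_eq_norm] using h z
  have := hg.mdifferentiableOn.eqOn_of_isPreconnected_of_isMaxOn_norm isPreconnected_univ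
    isOpen_univ (Set.mem_univ z₀) hmax (Set.mem_univ z)
  simpa using this

/-- A family of holomorphic functions, with all values taken on a compact set, of which only
countably many constants are members, consists of constants. -/
theorem forall_eq_of_countable_constants [ConnectedSpace M] {F : M → X → ℂ}
    (hF : Continuous fun q : M × X => F q.1 q.2)
    (hol : ∀ x, MDifferentiable 𝓘(ℂ, E) 𝓘(ℂ, ℂ) fun z => F z x)
    {K : Set M} (hK : IsCompact K) {Y : Set X} (hY : IsCompact Y)
    (hKY : ∀ z, ∀ x ∈ Y, ∃ z' ∈ K, ∃ x' ∈ Y, F z' x' = F z x)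
    (hT : {c | ∃ x ∈ Y, ∀ z, F z x = c}.Countable) {x : X} (hx : x ∈ Y) (z z' : M) :
    F z x = F z' x := by
  set T := {c | ∃ x ∈ Y, ∀ z, F z x = c}
  set C := (fun q : M × X => F q.1 q.2) '' (K ×ˢ Y)
  have hC : IsCompact C := (hK.prod hY).image hF
  have hmem : ∀ z, ∀ x ∈ Y, F z x ∈ C := fun z x hx => by
    obtain ⟨z', hz', x', hx', h⟩ := hKY z x hx
    exact ⟨(z', x'), ⟨hz', hx'⟩, h⟩
  have hF1 : ∀ z, Continuous (F z) := fun z => hF.comp (Continuous.prodMk_right z)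
  -- `T` is the image under `F z` of the compact set of parameters in `Y` with constant function.
  have hTclosed : IsClosed T := by
    have h1 : IsClosed {x | ∀ w, F w x = F z x} := by
      simp only [Set.ofPred_forall]
      exact isClosed_iInter fun w => isClosed_eq (hF1 w) (hF1 z)
    have h2 : T = F z '' (Y ∩ {x | ∀ w, F w x = F z x}) := by
      ext c
      constructor
      · rintro ⟨x, hx, h⟩
        exact ⟨x, ⟨hx, fun w => (h w).trans (h z).symm⟩, h z⟩
      · rintro ⟨x, ⟨hx, h⟩, rfl⟩
        exact ⟨x, hx, h⟩
    rw [h2]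
    exact ((hY.inter_right h1).image (hF1 z)).isClosed
  have hfront : frontier C ⊆ T := fun w hw => by
    rw [← hTclosed.closure_eq, Metric.mem_closure_iff]
    intro ε hε
    have hw' : w ∈ closure Cᶜ := by
      rw [frontier_eq_closure_inter_closure] at hw
      exact hw.2
    -- A point of `C` nearest to `c` is no farther from `c` than `w` is, hence within `ε` of `w`.
    obtain ⟨c, hc, hwc⟩ := Metric.mem_closure_iff.mp hw' (ε / 2) (half_pos hε)
    obtain ⟨v, hv, hvc⟩ := hC.exists_infDist_eq_dist ⟨_, hmem z x hx⟩ c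
    have hmin : ∀ u ∈ C, dist v c ≤ dist u c := fun u hu => by
      rw [dist_comm v, dist_comm u, ← hvc]
      exact Metric.infDist_le_dist_of_mem hu
    refine ⟨v, ?_, ?_⟩
    · obtain ⟨⟨z₀, x₀⟩, ⟨-, hx₀⟩, rfl⟩ := hv
      exact ⟨x₀, hx₀, (hol x₀).eq_of_forall_dist_le
        (c := c) (fun z h => hc (h ▸ hmem z x₀ hx₀)) fun z => hmin _ (hmem z x₀ hx₀)⟩
    · have h1 := hmin w (hC.isClosed.frontier_subset hw)
      have h2 := dist_triangle w c v
      rw [dist_comm c v] at h2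
      linarith
  have hrange : (Set.range fun w => F w x).Countable :=
    (countable_of_countable_frontier hC (hT.mono hfront)).mono
      (Set.range_subset_iff.mpr fun w => hmem w x hx)
  exact hrange.isTotallyDisconnected _ subset_rfl
    (isPreconnected_range (hol x).continuous) ⟨z, rfl⟩ ⟨z', rfl⟩

end MaximumPrinciple

/-! ### Holomorphic plainness of foliated bundles -/

section Plain

variable {G : Type*} [Group G]

/-- Over a convergence space, only countably many constants restrict to leaves. -/
theorem IsConvergenceSpace.countable_constants {M Γ X : Type*} [Group Γ] [MulAction Γ X]
    [TopologicalSpace X] (h : IsConvergenceSpace Γ X) [Nonempty M] {F : M → X → ℂ}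
    (hF : ∀ z, Continuous (F z))
    (hconst : ∀ (g : Γ) (x : X) (c : ℂ), (∀ z, F z x = c) → ∀ z, F z (g • x) = c) :
    {c | ∃ x ∈ (Set.univ : Set X), ∀ z, F z x = c}.Countable := by
  obtain ⟨𝒴, h𝒴, hinter, hlim⟩ := h
  obtain ⟨z₀⟩ := ‹Nonempty M›
  have := h𝒴.to_subtype
  choose γ a ha using hlim
  refine ((Set.countable_range fun Y : 𝒴 => F z₀ (a Y Y.2)).union (hinter.image (F z₀))).mono ?_
  rintro c ⟨y, -, hy⟩
  by_cases hyI : y ∈ ⋂₀ 𝒴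
  · exact Or.inr ⟨y, hyI, hy z₀⟩
  · rw [Set.mem_sInter] at hyI
    push Not at hyI
    obtain ⟨Y, hY, hyY⟩ := hyI
    refine Or.inl ⟨⟨Y, hY⟩, ?_⟩
    have h1 := ((hF z₀).tendsto (a Y hY)).comp (ha Y hY y hyY)
    have h2 : (F z₀ ∘ fun m => γ Y hY m • y) = fun _ => c :=
      funext fun m => hconst (γ Y hY m) y c hy z₀
    rw [h2] at h1
    exact tendsto_nhds_unique h1 tendsto_const_nhds

/-- Foliated bundles over compact manifolds are holomorphically plain if the holonomy group
is finite or acts on the compact fiber as on a convergence space. -/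
theorem isHolomorphicallyPlain_of_finite_or_isConvergenceSpace
    {E : Type*} [NormedAddCommGroup E] [NormedSpace ℂ E] [FiniteDimensional ℂ E]
    {B : Type*} [TopologicalSpace B] [ChartedSpace E B] [CompactSpace B] [ConnectedSpace B]
    {M : Type*} [TopologicalSpace M] [ChartedSpace E M] [IsManifold 𝓘(ℂ, E) ω M]
    [SimplyConnectedSpace M] {p : M → B} (hp : IsCoveringMap p) (ρ : DeckGroup p →* G)
    {X : Type*} [TopologicalSpace X] [CompactSpace X] [MulAction G X]
    (h : (ρ.range : Set G).Finite ∨ IsConvergenceSpace ρ.range X) :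
    FoliatedBundle.IsHolomorphicallyPlain p ρ X E := by
  intro f hf hol
  have : ProperSpace E := FiniteDimensional.proper ℂ E
  have : LocallyCompactSpace M := ChartedSpace.locallyCompactSpace E M
  have : LocallyPathConnectedSpace M := ChartedSpace.locallyPathConnectedSpace E M
  have : LocallyPathConnectedSpace B := ChartedSpace.locallyPathConnectedSpace E B
  have : PathConnectedSpace B := pathConnectedSpace_iff_connectedSpace.mpr inferInstance
  obtain ⟨K, hK, hpK⟩ := hp.isOpenMap.exists_isCompact_image_eq_univ
    hp.surjective_of_pathConnectedSpace
  let F : M → X → ℂ := fun z x => f (FoliatedBundle.leafMap p ρ x z)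
  have hF : Continuous fun q : M × X => F q.1 q.2 := hf.comp continuous_quot_mk
  have hinv : ∀ (γ : DeckGroup p) (z : M) (x : X), F (γ.1 z) (ρ γ • x) = F z x := fun γ z x =>
    congrArg f (Quotient.sound ⟨γ, rfl⟩ : Quotient.mk (foliatedBundleSetoid p ρ X) (z, x) = _).symm
  have hconst : ∀ (g : ρ.range) (x : X) (c : ℂ), (∀ z, F z x = c) → ∀ z, F z (g • x) = c := by
    rintro ⟨_, γ, rfl⟩ x c hx z
    obtain ⟨w, rfl⟩ := γ.1.surjective z
    exact (hinv γ w x).trans (hx w)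
  have key : ∀ x z z', F z x = F z' x := fun x z z' => by
    -- Deck transformations move every point of `M` into `K`, so all values over a
    -- holonomy-invariant `Y` are taken on `K ×ˢ Y`.
    have hKY : ∀ Y : Set X, (∀ γ, ∀ y ∈ Y, ρ γ • y ∈ Y) →
        ∀ z, ∀ y ∈ Y, ∃ z' ∈ K, ∃ y' ∈ Y, F z' y' = F z y := fun Y hY z y hy => by
      obtain ⟨z', hz', hpz⟩ : p z ∈ p '' K := hpK ▸ Set.mem_univ _
      obtain ⟨γ, rfl⟩ := hp.exists_deckGroup_apply_eq hpz.symm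
      exact ⟨_, hz', ρ γ • y, hY γ y hy, hinv γ z y⟩
    rcases h with hfin | hconv
    -- Take `Y` to be the finite holonomy orbit of `x`: it is compact and invariant, and carries
    -- finitely many constants.
    · have hY : ((fun g : G => g • x) '' (ρ.range : Set G)).Finite := hfin.image _
      refine forall_eq_of_countable_constants hF hol hK hY.isCompact (hKY _ ?_) ?_
        ⟨1, one_mem _, one_smul _ _⟩ z z'
      · rintro γ _ ⟨g, hg, rfl⟩
        exact ⟨ρ γ * g, mul_mem ⟨γ, rfl⟩ hg, mul_smul _ _ _⟩
      · refine (hY.image (F z)).countable.mono ?_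
        rintro c ⟨y, hy, h⟩
        exact ⟨y, hy, h z⟩
    · exact forall_eq_of_countable_constants hF hol hK isCompact_univ
        (hKY _ fun _ _ _ => Set.mem_univ _) (hconv.countable_constants
          (fun z => hF.comp (Continuous.prodMk_right z)) hconst) (Set.mem_univ x) z z'
  rintro x _ ⟨z, rfl⟩ _ ⟨z', rfl⟩
  exact key x z z'

end Plain

theorem mainTheorem8
    {G : Type*} [Group G] (S : Set G) (hS : IsHyperbolicGeneratingSet S) :
    (∀ {E : Type*} [NormedAddCommGroup E] [NormedSpace ℂ E] [FiniteDimensional ℂ E]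
      {B : Type*} [TopologicalSpace B] [ChartedSpace E B] [IsManifold 𝓘(ℂ, E) ω B]
      [T2Space B] [CompactSpace B] [ConnectedSpace B]
      {M : Type*} [TopologicalSpace M] [ChartedSpace E M] [IsManifold 𝓘(ℂ, E) ω M]
      [SimplyConnectedSpace M]
      (p : M → B) (_ : IsCoveringMap p) (_ : IsLocalDiffeomorph 𝓘(ℂ, E) 𝓘(ℂ, E) ω p)
      (ρ : DeckGroup p →* G),
        FoliatedBundle.IsHolomorphicallyPlain p ρ (GromovBoundary S) E) ∧
    (∀ H : Subgroup G, IsUnboundedSubgroup S H → IsConvergenceSpace H (GromovBoundary S)) := by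
  refine ⟨?_, fun H hH => isConvergenceSpace_of_isUnboundedSubgroup hS hH⟩
  intro E _ _ _ B _ _ _ _ _ _ M _ _ _ _ p hp _ ρ
  have := compactSpace_gromovBoundary hS
  refine isHolomorphicallyPlain_of_finite_or_isConvergenceSpace hp ρ ?_
  by_cases hH : IsUnboundedSubgroup S ρ.range
  · exact Or.inr (isConvergenceSpace_of_isUnboundedSubgroup hS hH)
  · exact Or.inl (finite_of_not_isUnboundedSubgroup hS hH)
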